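/- Let $K$ be a field, let $n\ge 3$ and $m=\binom n2$. Let $S=K[b_{i,x},b_{i,y},q_{j,k}]$ be the polynomial ring in the coordinates of $m$ points $b_i=(b_{i,x},b_{i,y})$ ($1\le i\le m$) of $\mathbb A^2$ and in the coefficients of three binary quadratic forms $Q_j=q_{j,0}v^2+q_{j,1}uv+q_{j,2}u^2$ ($j=0,1,2$); write $B=(b_1,\dots,b_m)$ and $Q=(Q_0,Q_1,Q_2)$. Define the following objects over $S$. * $\mathtt V_B$ is the $m\times m$ matrix whose $i$-th row lists the values at $b_i$ of the monomials $1,x,y,x^2,xy,y^2,\dots,y^{n-2}$ of degree at most $n-2$. $\mathtt R_B$ is the $m\times n$ matrix whose $i$-th row lists the values at $b_i$ of $x^{n-1},x^{n-2}y,\dots,y^{n-1}$. With $\mathtt V_B^*$ the adjugate of $\mathtt V_B$, put $\mathtt K_B=\begin{pmatrix}-\mathtt V_B^*\mathtt R_B\\ \det(\mathtt V_B)\,\mathtt I_n\end{pmatrix}$. * $\beta'_1,\dots,\beta'_n$ are the ternary forms of degree $n-1$ in $Z,X,Y$ whose coefficient vectors are the columns of $\mathtt K_B$; here the first $m$ rows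 correspond to the monomials $Z^{n-1-a-b}X^aY^b$, where $x^ay^b$ runs through the monomials of degree at most $n-2$ in the above order, and the last $n$ rows to $X^{n-1},X^{n-2}Y,\dots,Y^{n-1}$. Put $P'_i(u,v)=\beta'_i(Q_0,Q_1,Q_2)$, with $(Q_0,Q_1,Q_2)$ substituted for $(Z,X,Y)$. This is a binary form of degree $2n-2$. * $\mathcal A(B,Q)\in S$ is the determinant of the $2n\times 2n$ matrix whose columns are the coefficient vectors of $uP'_1,vP'_1,\dots,uP'_n,vP'_n$ with respect to the monomials $u^{2n-1},u^{2n-2}v,\dots,v^{2n-1}$. * $\rho_i=\operatorname{Res}(Q_1-b_{i,x}Q_0,\;Q_2-b_{i,y}Q_0)\in S$ is the resultant of two binary quadratic forms (the $4\times4$ Sylvester determinant), and $\mathcal R(B,Q)=\prod_{i=1}^m\rho_i$. Then $$\mathcal A(B,Q)=(\det\mathtt V_B)^{2n}\cdot\mathcal R(B,Q)$$ as polynomials in $S$. Moreover, whenever $\mathcal A(B,Q)=c\cdot(\det\mathtt V_B)^d\cdot\prod_{i=1}^m\rho_i^{N_i}$ with $c\in K$ and integers $d>0$ and $N_1,\dots,N_m>0$,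 one has $c=1$, $d=2n$ and $N_i=1$ for all $i$. -/

import Mathlib

/-!
# Index determinant and product of resultants attached to a parameterized plane conic

Throughout, `n` is the number of coordinate polynomials, `m = n.choose 2` is the number of points,
and everything is defined over an arbitrary commutative ring `R`, so that it can be evaluated at the
generic configuration (whose coordinates are the variables of a polynomial ring).

* A configuration `B` of `m` points of the affine plane is a map `Fin (n.choose 2) → Fin 2 → R`;
  the point `b_i` is `(B i 0, B i 1) = (b_{i,x}, b_{i,y})`.
* Binary forms in `u, v` are elements of `MvPolynomial (Fin 2) R`, with `u = X 0` and `v = X 1`.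
* Ternary forms are elements of `MvPolynomial (Fin 3) R`, with `Z = X 0` (the coordinate that
  vanishes on the line at infinity), `X = X 1` and `Y = X 2`.
* A parameterized conic is a triple `Q : Fin 3 → MvPolynomial (Fin 2) R` of binary quadratic forms.
-/

namespace ConicIndex

open MvPolynomial

theorem sum_fin_succ_eq_choose_two (n : ℕ) :
    ∑ d : Fin (n - 1), ((d : ℕ) + 1) = n.choose 2 := by
  rw [Fin.sum_univ_eq_sum_range (fun d => d + 1) (n - 1)]
  cases n with
  | zero => rfl
  | succ k =>
    rw [Nat.add_sub_cancel]
    induction k with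
    | zero => rfl
    | succ k ih =>
      rw [Finset.sum_range_succ, ih, Nat.choose_succ_succ' (k + 1) 1, Nat.choose_one_right,
        add_comm]

/-- The numbering `1, x, y, x ^ 2, x y, y ^ 2, …, y ^ (n - 2)` of the monomials of degree at most
`n - 2` in two variables. The pair `⟨d, j⟩` stands for `x ^ (d - j) * y ^ j`; the numbering is
lexicographic in `(d, j)`. -/
def monomialNumbering (n : ℕ) : ((d : Fin (n - 1)) × Fin ((d : ℕ) + 1)) ≃ Fin (n.choose 2) :=
  finSigmaFinEquiv.trans (finCongr (sum_fin_succ_eq_choose_two n))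

/-- Exponent of `x` in the `k`-th monomial of degree at most `n - 2`. -/
def expX (n : ℕ) (k : Fin (n.choose 2)) : ℕ :=
  (((monomialNumbering n).symm k).1 : ℕ) - (((monomialNumbering n).symm k).2 : ℕ)

/-- Exponent of `y` in the `k`-th monomial of degree at most `n - 2`. -/
def expY (n : ℕ) (k : Fin (n.choose 2)) : ℕ :=
  (((monomialNumbering n).symm k).2 : ℕ)

variable {R : Type*} [CommRing R]

/-- The interpolation matrix `V_B`: the row of the point `b` lists the values at `b` of the
monomials `1, x, y, x ^ 2, x y, …, y ^ (n - 2)`. -/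
def interpolationMatrix (n : ℕ) (B : Fin (n.choose 2) → Fin 2 → R) :
    Matrix (Fin (n.choose 2)) (Fin (n.choose 2)) R :=
  Matrix.of fun i k => B i 0 ^ expX n k * B i 1 ^ expY n k

/-- The matrix `R_B`: the row of the point `b` lists the values at `b` of the monomials
`x ^ (n - 1), x ^ (n - 2) y, …, y ^ (n - 1)`. -/
def topDegreeMatrix (n : ℕ) (B : Fin (n.choose 2) → Fin 2 → R) :
    Matrix (Fin (n.choose 2)) (Fin n) R :=
  Matrix.of fun i j => B i 0 ^ (n - 1 - (j : ℕ)) * B i 1 ^ (j : ℕ)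

/-- The block matrix `K_B`, with upper block `- adj(V_B) * R_B` and lower block `det(V_B) • 1`.
Its columns lie in the kernel of the block matrix `[V_B | R_B]`. -/
def kernelMatrix (n : ℕ) (B : Fin (n.choose 2) → Fin 2 → R) :
    Matrix (Fin (n.choose 2) ⊕ Fin n) (Fin n) R :=
  Matrix.fromRows (-((interpolationMatrix n B).adjugate * topDegreeMatrix n B))
    ((interpolationMatrix n B).det • (1 : Matrix (Fin n) (Fin n) R))

/-- The ternary monomials of degree `n - 1`, indexed as the columns of `[V_B | R_B]`: first the
homogenizations of the monomials of degree at most `n - 2` in `x, y`, then the monomials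
of degree `n - 1` in `X, Y`. -/
noncomputable def ternaryMonomial (R : Type*) [CommRing R] (n : ℕ) :
    Fin (n.choose 2) ⊕ Fin n → MvPolynomial (Fin 3) R
  | Sum.inl k => X 0 ^ (n - 1 - (expX n k + expY n k)) * X 1 ^ expX n k * X 2 ^ expY n k
  | Sum.inr j => X 1 ^ (n - 1 - (j : ℕ)) * X 2 ^ (j : ℕ)

/-- `β'`: the `i`-th ternary form of degree `n - 1` has the `i`-th column of `K_B` as its vector of
coefficients. If `det V_B` is a unit, these forms are a basis of the forms of degree `n - 1` that
vanish on `B`. -/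
noncomputable def basisForm (n : ℕ) (B : Fin (n.choose 2) → Fin 2 → R) (i : Fin n) :
    MvPolynomial (Fin 3) R :=
  ∑ r, C (kernelMatrix n B r i) * ternaryMonomial R n r

/-- The coordinate polynomials `P'_1, …, P'_n` of `g_{B,β'} ∘ [Q_0 : Q_1 : Q_2]`, that is, the
binary forms `β'_i(Q_0, Q_1, Q_2)` of degree `2 n - 2`. -/
noncomputable def curveCoordinate (n : ℕ) (B : Fin (n.choose 2) → Fin 2 → R)
    (Q : Fin 3 → MvPolynomial (Fin 2) R) (i : Fin n) : MvPolynomial (Fin 2) R :=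
  aeval Q (basisForm n B i)

/-- The index matrix `A_{P_1, …, P_n}` of binary forms `P_1, …, P_n` of degree `2 n - 2`. It has
`2 n` rows and columns; the columns are the coefficient vectors of
`u P_1, v P_1, …, u P_n, v P_n` in the monomials
`u ^ (2 n - 1), u ^ (2 n - 2) v, …, v ^ (2 n - 1)`. -/
noncomputable def indexMatrix (n : ℕ) (P : Fin n → MvPolynomial (Fin 2) R) :
    Matrix (Fin (n * 2)) (Fin (n * 2)) R :=
  Matrix.of fun r c =>
    coeff (Finsupp.single 0 (2 * n - 1 - (r : ℕ)) + Finsupp.single 1 (r : ℕ))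
      (X c.modNat * P c.divNat)

/-- `𝒜(B, Q)`, the determinant of the index matrix of `g_{B,β'} ∘ Q`. -/
noncomputable def indexDet (n : ℕ) (B : Fin (n.choose 2) → Fin 2 → R)
    (Q : Fin 3 → MvPolynomial (Fin 2) R) : R :=
  (indexMatrix n (curveCoordinate n B Q)).det

/-- The resultant of two binary quadratic forms: the `4 × 4` Sylvester determinant (of formal
degrees `2, 2`) of the polynomials obtained by setting `v = 1`. -/
noncomputable def quadraticResultant (f g : MvPolynomial (Fin 2) R) : R :=
  Polynomial.resultant (aeval ![Polynomial.X, 1] f : Polynomial R) (aeval ![Polynomial.X, 1] g) 2 2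

/-- The factor `Res(Q_1 - b_x Q_0, Q_2 - b_y Q_0)` attached to the point `b = (b 0, b 1)`. -/
noncomputable def pointResultant (b : Fin 2 → R) (Q : Fin 3 → MvPolynomial (Fin 2) R) : R :=
  quadraticResultant (Q 1 - C (b 0) * Q 0) (Q 2 - C (b 1) * Q 0)

/-- `ℛ(B, Q)`, the product of the resultants attached to the points of `B`. -/
noncomputable def resultantProd (n : ℕ) (B : Fin (n.choose 2) → Fin 2 → R)
    (Q : Fin 3 → MvPolynomial (Fin 2) R) : R :=
  ∏ i, pointResultant (B i) Q

/-- The coordinates on the affine space of pairs `(B, Q)`: the two coordinates of each of the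
`n.choose 2` points, and the three coefficients of each of `Q_0, Q_1, Q_2`. -/
abbrev Coord (n : ℕ) : Type := (Fin (n.choose 2) × Fin 2) ⊕ (Fin 3 × Fin 3)

/-- The generic configuration of points. -/
noncomputable def genericPoints (K : Type*) [CommRing K] (n : ℕ) :
    Fin (n.choose 2) → Fin 2 → MvPolynomial (Coord n) K :=
  fun i a => X (Sum.inl (i, a))

/-- The generic parameterized conic, with `Q_i = q_{i,0} v ^ 2 + q_{i,1} u v + q_{i,2} u ^ 2`. -/
noncomputable def genericConic (K : Type*) [CommRing K] (n : ℕ) :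
    Fin 3 → MvPolynomial (Fin 2) (MvPolynomial (Coord n) K) :=
  fun i => C (X (Sum.inr (i, 0))) * X 1 ^ 2 + C (X (Sum.inr (i, 1))) * (X 0 * X 1)
    + C (X (Sum.inr (i, 2))) * X 0 ^ 2

end ConicIndex

namespace ConicIndex

open MvPolynomial

variable {R : Type*} [CommRing R]

/-! Write `D = det V_B`, and let `s_i` be the subresultant of the two forms whose resultant is
`ρ_i`. Modulo `ρ_i` these forms vanish together at an explicit point `p` with second coordinate
`s_i`. There `Q` is proportional to `(1, b_i)`, so every `P'_j` vanishes at `p`, and the values at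
`p` of the monomials of degree `2n-1` form a row vector killed by the index matrix. Hence `ρ_i ∣ s_i
^ (2n-1) * 𝒜` over every commutative ring (`pointResultant_dvd_subresultant_pow_mul_indexDet`).

For generic data `ρ_i` is coprime to `s_i` and to every other `ρ_j`, so `ℛ ∣ 𝒜`; irreducibility of
`ρ_i` is not needed. Both sides are homogeneous in `Q` of degree `2n(n-1) = 4 * n.choose 2`, so the
quotient depends on `B` alone. At `Q = (0, u^2, v^2)` every `ρ_i` is `1` and the index matrix is `D
• 1`, so the quotient is `D ^ (2n)`.

The exponents and the constant are unique because `D` and the `ρ_i` are nonzero nonunits: the same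
specialization determines `c` and `d`, and cancelling `ℛ` determines the `N_i`. -/

theorem expX_add_expY_lt {n : ℕ} (k : Fin (n.choose 2)) : expX n k + expY n k < n - 1 := by
  have h1 := ((monomialNumbering n).symm k).1.isLt
  have h2 := ((monomialNumbering n).symm k).2.isLt
  unfold expX expY
  omega

/-- The values of the ternary monomials of degree `n - 1` at a triple of elements of a ring. -/
def monomialValue {A : Type*} [CommRing A] (n : ℕ) (z : Fin 3 → A) :
    Fin (n.choose 2) ⊕ Fin n → A
  | Sum.inl k => z 0 ^ (n - 1 - (expX n k + expY n k)) * z 1 ^ expX n k * z 2 ^ expY n k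
  | Sum.inr j => z 1 ^ (n - 1 - (j : ℕ)) * z 2 ^ (j : ℕ)

theorem monomialValue_mul {A : Type*} [CommRing A] (n : ℕ) (c : A) (z : Fin 3 → A)
    (r : Fin (n.choose 2) ⊕ Fin n) :
    monomialValue n (fun k => c * z k) r = c ^ (n - 1) * monomialValue n z r := by
  cases r with
  | inl k =>
    have h := (expX_add_expY_lt k).le
    have e : c ^ (n - 1) = c ^ (n - 1 - (expX n k + expY n k)) * c ^ expX n k * c ^ expY n k := by
      rw [← pow_add, ← pow_add]; congr 1; omega
    simp only [monomialValue, mul_pow, e]; ring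
  | inr j =>
    have h := j.isLt
    have e : c ^ (n - 1) = c ^ (n - 1 - (j : ℕ)) * c ^ (j : ℕ) := by
      rw [← pow_add]; congr 1; omega
    simp only [monomialValue, mul_pow, e]; ring

theorem map_monomialValue {A A' : Type*} [CommRing A] [CommRing A'] (φ : A →+* A') (n : ℕ)
    (z : Fin 3 → A) (r : Fin (n.choose 2) ⊕ Fin n) :
    φ (monomialValue n z r) = monomialValue n (fun k => φ (z k)) r := by
  cases r <;> simp [monomialValue]

theorem curveCoordinate_eq_sum (n : ℕ) (B : Fin (n.choose 2) → Fin 2 → R)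
    (Q : Fin 3 → MvPolynomial (Fin 2) R) (i : Fin n) :
    curveCoordinate n B Q i = ∑ r, C (kernelMatrix n B r i) * monomialValue n Q r := by
  simp only [curveCoordinate, basisForm, map_sum, map_mul]
  refine Finset.sum_congr rfl fun r _ => ?_
  congr 1
  · simp [algebraMap_eq]
  · cases r <;> simp [ternaryMonomial, monomialValue]

/-- The forms `β'` vanish at the points of the configuration. -/
theorem sum_kernelMatrix_mul_monomialValue (n : ℕ) (B : Fin (n.choose 2) → Fin 2 → R)
    (i : Fin (n.choose 2)) (j : Fin n) :
    ∑ r, kernelMatrix n B r j * monomialValue n ![1, B i 0, B i 1] r = 0 := by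
  have h : Matrix.fromCols (interpolationMatrix n B) (topDegreeMatrix n B) * kernelMatrix n B
      = 0 := by
    rw [kernelMatrix, Matrix.fromCols_mul_fromRows, Matrix.mul_neg, ← Matrix.mul_assoc,
      Matrix.mul_adjugate]
    simp
  have h' := congrFun (congrFun h i) j
  rw [Matrix.mul_apply] at h'
  rw [← Matrix.zero_apply (α := R) i j, ← h']
  refine Finset.sum_congr rfl fun r _ => ?_
  rw [mul_comm]
  congr 1
  cases r <;> simp [monomialValue, interpolationMatrix, topDegreeMatrix]

/-! ### Compatibility with ring homomorphisms -/

section Map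

variable {R' : Type*} [CommRing R'] (φ : R →+* R')

theorem map_det_interpolationMatrix (n : ℕ) (B : Fin (n.choose 2) → Fin 2 → R) :
    φ (interpolationMatrix n B).det = (interpolationMatrix n fun i a => φ (B i a)).det := by
  rw [RingHom.map_det]
  congr 1
  ext i k
  simp [interpolationMatrix]

theorem map_kernelMatrix (n : ℕ) (B : Fin (n.choose 2) → Fin 2 → R)
    (r : Fin (n.choose 2) ⊕ Fin n) (i : Fin n) :
    φ (kernelMatrix n B r i) = kernelMatrix n (fun i a => φ (B i a)) r i := by
  have hV : (interpolationMatrix n B).map φ = interpolationMatrix n fun i a => φ (B i a) := by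
    ext i k; simp [interpolationMatrix]
  have hR : (topDegreeMatrix n B).map φ = topDegreeMatrix n fun i a => φ (B i a) := by
    ext i k; simp [topDegreeMatrix]
  have hA : (interpolationMatrix n B).adjugate.map φ
      = (interpolationMatrix n fun i a => φ (B i a)).adjugate := by
    rw [← hV]; exact RingHom.map_adjugate φ _
  cases r with
  | inl k =>
    simp only [kernelMatrix, Matrix.fromRows_apply_inl, Matrix.neg_apply, map_neg]
    rw [← hA, ← hR, ← Matrix.map_mul]
    rfl
  | inr k =>
    simp only [kernelMatrix, Matrix.fromRows_apply_inr, Matrix.smul_apply, smul_eq_mul, map_mul,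
      map_det_interpolationMatrix, Matrix.one_apply]
    split_ifs <;> simp

theorem map_curveCoordinate (n : ℕ) (B : Fin (n.choose 2) → Fin 2 → R)
    (Q : Fin 3 → MvPolynomial (Fin 2) R) (i : Fin n) :
    map φ (curveCoordinate n B Q i)
      = curveCoordinate n (fun i a => φ (B i a)) (fun k => map φ (Q k)) i := by
  simp only [curveCoordinate_eq_sum, map_sum, map_mul, map_C, map_kernelMatrix, map_monomialValue]

/-- This serves three changes of ring: reduction modulo `ρ_i`, specialization of the generic
coordinates, and adjunction of a scaling variable. -/
theorem map_indexDet (n : ℕ) (B : Fin (n.choose 2) → Fin 2 → R)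
    (Q : Fin 3 → MvPolynomial (Fin 2) R) :
    φ (indexDet n B Q) = indexDet n (fun i a => φ (B i a)) fun k => map φ (Q k) := by
  rw [indexDet, indexDet, RingHom.map_det]
  congr 1
  ext r c
  simp only [indexMatrix, RingHom.mapMatrix_apply, Matrix.map_apply, Matrix.of_apply,
    ← map_curveCoordinate]
  rw [← coeff_map, map_mul, map_X]

end Map

/-- Replacing `Q` by `t Q` multiplies `𝒜(B, Q)` by `t ^ (2 n (n - 1))`. -/
theorem indexDet_C_mul (n : ℕ) (B : Fin (n.choose 2) → Fin 2 → R)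
    (Q : Fin 3 → MvPolynomial (Fin 2) R) (t : R) :
    indexDet n B (fun k => C t * Q k) = t ^ ((n - 1) * (n * 2)) * indexDet n B Q := by
  have h : indexMatrix n (curveCoordinate n B fun k => C t * Q k)
      = t ^ (n - 1) • indexMatrix n (curveCoordinate n B Q) := by
    ext r c
    have e : curveCoordinate n B (fun k => C t * Q k) c.divNat
        = C (t ^ (n - 1)) * curveCoordinate n B Q c.divNat := by
      simp only [curveCoordinate_eq_sum, monomialValue_mul, Finset.mul_sum, map_pow]
      refine Finset.sum_congr rfl fun r _ => by ring
    simp only [indexMatrix, Matrix.of_apply, Matrix.smul_apply, e, smul_eq_mul]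
    rw [mul_left_comm, coeff_C_mul]
  rw [indexDet, indexDet, h, Matrix.det_smul, Fintype.card_fin, ← pow_mul]

/-! ### Binary forms and the rows of the index matrix -/

/-- The triple of binary quadratic forms with a given matrix of coefficients. -/
noncomputable def conic (q : Fin 3 → Fin 3 → R) : Fin 3 → MvPolynomial (Fin 2) R :=
  fun i => C (q i 0) * X 1 ^ 2 + C (q i 1) * (X 0 * X 1) + C (q i 2) * X 0 ^ 2

theorem isHomogeneous_conic (q : Fin 3 → Fin 3 → R) (i : Fin 3) : (conic q i).IsHomogeneous 2 := by
  unfold conic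
  refine ((?_ : IsHomogeneous _ _).add ?_).add ?_
  · simpa using (isHomogeneous_C (Fin 2) (q i 0)).mul ((isHomogeneous_X R (1 : Fin 2)).pow 2)
  · simpa using (isHomogeneous_C (Fin 2) (q i 1)).mul
      ((isHomogeneous_X R (0 : Fin 2)).mul (isHomogeneous_X R (1 : Fin 2)))
  · simpa using (isHomogeneous_C (Fin 2) (q i 2)).mul ((isHomogeneous_X R (0 : Fin 2)).pow 2)

theorem isHomogeneous_monomialValue {n : ℕ} {d : ℕ} {Q : Fin 3 → MvPolynomial (Fin 2) R}
    (hQ : ∀ k, (Q k).IsHomogeneous d) (r : Fin (n.choose 2) ⊕ Fin n) :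
    (monomialValue n Q r).IsHomogeneous (d * (n - 1)) := by
  cases r with
  | inl k =>
    have h := (expX_add_expY_lt k).le
    have := (((hQ 0).pow (n - 1 - (expX n k + expY n k))).mul ((hQ 1).pow (expX n k))).mul
      ((hQ 2).pow (expY n k))
    rwa [← mul_add, ← mul_add,
      show n - 1 - (expX n k + expY n k) + expX n k + expY n k = n - 1 by omega] at this
  | inr j =>
    have h := j.isLt
    have := ((hQ 1).pow (n - 1 - (j : ℕ))).mul ((hQ 2).pow (j : ℕ))
    rwa [← mul_add, show n - 1 - (j : ℕ) + (j : ℕ) = n - 1 by omega] at this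

theorem isHomogeneous_curveCoordinate {n : ℕ} {d : ℕ} (B : Fin (n.choose 2) → Fin 2 → R)
    {Q : Fin 3 → MvPolynomial (Fin 2) R} (hQ : ∀ k, (Q k).IsHomogeneous d) (i : Fin n) :
    (curveCoordinate n B Q i).IsHomogeneous (d * (n - 1)) := by
  rw [curveCoordinate_eq_sum]
  refine IsHomogeneous.sum _ _ _ fun r _ => ?_
  simpa using (isHomogeneous_C (Fin 2) _).mul (isHomogeneous_monomialValue hQ r)

/-- A binary form is evaluated by summing over its coefficients. -/
theorem eval_eq_sum_coeff_of_isHomogeneous {d : ℕ} {F : MvPolynomial (Fin 2) R}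
    (hF : F.IsHomogeneous d) (p : Fin 2 → R) :
    eval p F = ∑ r ∈ Finset.range (d + 1),
      p 0 ^ (d - r) * p 1 ^ r * coeff (Finsupp.single 0 (d - r) + Finsupp.single 1 r) F := by
  rw [eval_eq']
  have key : ∀ s ∈ F.support, s 0 + s 1 = d := fun s hs => by
    have := hF (mem_support_iff.mp hs)
    rw [Finsupp.weight_apply, Finsupp.sum_fintype _ _ (by simp)] at this
    simpa using this
  -- By homogeneity an exponent in the support is determined by its second entry.
  refine Finset.sum_of_injOn (fun s => s 1) ?_ ?_ ?_ ?_
  · intro s hs t ht hst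
    have h1 := key s hs
    have h2 := key t ht
    ext k
    fin_cases k <;> simp at * <;> omega
  · intro s hs
    have h1 := key s hs
    simp; omega
  · intro r hr hr'
    rw [mul_eq_zero_of_right]
    by_contra hne
    refine hr' ⟨_, mem_support_iff.mpr hne, ?_⟩
    simp
  · intro s hs
    have h1 := key s hs
    have e : Finsupp.single 0 (d - s 1) + Finsupp.single 1 (s 1) = s := by
      ext k
      fin_cases k <;> (simp; try omega)
    simp only [e, Fin.prod_univ_two]
    rw [mul_comm, ← Nat.eq_sub_of_add_eq h1]

/-- A column holds the coefficients of `u P_i` or `v P_i`, so pairing it with monomial values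
evaluates that form. A common zero of the `P_i` thus gives a left kernel vector. -/
theorem sum_pow_mul_indexMatrix {n : ℕ} (hn : 1 ≤ n) {P : Fin n → MvPolynomial (Fin 2) R}
    (hP : ∀ i, (P i).IsHomogeneous (2 * (n - 1))) (p : Fin 2 → R) (c : Fin (n * 2)) :
    ∑ r : Fin (n * 2), p 0 ^ (2 * n - 1 - (r : ℕ)) * p 1 ^ (r : ℕ) * indexMatrix n P r c
      = p c.modNat * eval p (P c.divNat) := by
  have hF : (X c.modNat * P c.divNat).IsHomogeneous (2 * n - 1) := by
    convert (isHomogeneous_X R c.modNat).mul (hP c.divNat) using 1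
    omega
  have h := eval_eq_sum_coeff_of_isHomogeneous hF p
  rw [map_mul, eval_X] at h
  rw [h, show 2 * n - 1 + 1 = n * 2 by omega, Finset.sum_range]
  rfl

/-! ### Resultants of two binary quadratic forms -/

/-- The resultant of `f 0 + f 1 x + f 2 x ^ 2` and `g 0 + g 1 x + g 2 x ^ 2`. -/
def coeffResultant (f g : Fin 3 → R) : R :=
  (f 2 * g 0 - g 2 * f 0) ^ 2 - (f 2 * g 1 - g 2 * f 1) * (f 1 * g 0 - g 1 * f 0)

theorem resultant_two_two (f g : Polynomial R) :
    Polynomial.resultant f g 2 2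
      = coeffResultant (fun k => f.coeff k) (fun k => g.coeff k) := by
  have h : Polynomial.sylvester f g 2 2 =
      !![g.coeff 0, 0, f.coeff 0, 0; g.coeff 1, g.coeff 0, f.coeff 1, f.coeff 0;
         g.coeff 2, g.coeff 1, f.coeff 2, f.coeff 1; 0, g.coeff 2, 0, f.coeff 2] := by
    ext i j
    fin_cases j
    · change (if (i : ℕ) ∈ Set.Icc 0 (0 + 2) then g.coeff ((i : ℕ) - 0) else 0) = _
      fin_cases i <;> simp
    · change (if (i : ℕ) ∈ Set.Icc 1 (1 + 2) then g.coeff ((i : ℕ) - 1) else 0) = _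
      fin_cases i <;> simp
    · change (if (i : ℕ) ∈ Set.Icc 0 (0 + 2) then f.coeff ((i : ℕ) - 0) else 0) = _
      fin_cases i <;> simp
    · change (if (i : ℕ) ∈ Set.Icc 1 (1 + 2) then f.coeff ((i : ℕ) - 1) else 0) = _
      fin_cases i <;> simp
  rw [Polynomial.resultant, h]
  simp [Matrix.det_succ_row_zero, Fin.sum_univ_succ, Fin.succAbove, coeffResultant]
  ring

/-- The coefficients of `Q_1 - b_x Q_0`. -/
def abscissaForm (b : Fin 2 → R) (q : Fin 3 → Fin 3 → R) (k : Fin 3) : R :=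
  q 1 k - b 0 * q 0 k

/-- The coefficients of `Q_2 - b_y Q_0`. -/
def ordinateForm (b : Fin 2 → R) (q : Fin 3 → Fin 3 → R) (k : Fin 3) : R :=
  q 2 k - b 1 * q 0 k

theorem pointResultant_conic (b : Fin 2 → R) (q : Fin 3 → Fin 3 → R) :
    pointResultant b (conic q) = coeffResultant (abscissaForm b q) (ordinateForm b q) := by
  rw [pointResultant, quadraticResultant, resultant_two_two]
  have key : ∀ (i : Fin 3) (c : R) (k : Fin 3),
      (aeval ![Polynomial.X, 1] (conic q i - C c * conic q 0) : Polynomial R).coeff k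
        = q i k - c * q 0 k := by
    intro i c k
    simp only [conic, map_sub, map_add, map_mul, map_pow, aeval_C, aeval_X,
      Matrix.cons_val_zero, Matrix.cons_val_one, Polynomial.algebraMap_eq, one_pow, mul_one,
      Polynomial.coeff_sub, Polynomial.coeff_C_mul, Polynomial.coeff_add]
    fin_cases k <;> simp [Polynomial.coeff_X, Polynomial.coeff_C,
      Polynomial.coeff_X_pow]
  congr 1 <;> funext k <;> exact key _ _ k

theorem map_coeffResultant {R' : Type*} [CommRing R'] (φ : R →+* R') (f g : Fin 3 → R) :
    φ (coeffResultant f g) = coeffResultant (fun k => φ (f k)) fun k => φ (g k) := by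
  simp [coeffResultant]

theorem map_conic {R' : Type*} [CommRing R'] (φ : R →+* R') (q : Fin 3 → Fin 3 → R) (i : Fin 3) :
    map φ (conic q i) = conic (fun k l => φ (q k l)) i := by
  simp [conic]

theorem map_pointResultant_conic {R' : Type*} [CommRing R'] (φ : R →+* R') (b : Fin 2 → R)
    (q : Fin 3 → Fin 3 → R) :
    φ (pointResultant b (conic q))
      = pointResultant (fun a => φ (b a)) (conic fun k l => φ (q k l)) := by
  simp only [pointResultant_conic, map_coeffResultant, abscissaForm, ordinateForm, map_sub, map_mul]
  rfl

theorem map_indexDet_conic {R' : Type*} [CommRing R'] (φ : R →+* R') (n : ℕ)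
    (B : Fin (n.choose 2) → Fin 2 → R) (q : Fin 3 → Fin 3 → R) :
    φ (indexDet n B (conic q))
      = indexDet n (fun i a => φ (B i a)) (conic fun k l => φ (q k l)) := by
  rw [map_indexDet]
  congr 1
  funext k
  exact map_conic φ q k

theorem eval_conic (q : Fin 3 → Fin 3 → R) (p : Fin 2 → R) (i : Fin 3) :
    eval p (conic q i) = q i 0 * p 1 ^ 2 + q i 1 * (p 0 * p 1) + q i 2 * p 0 ^ 2 := by
  simp [conic]

/-! ### Vanishing at a common root modulo a point resultant -/

/-- The linear factor of the pencil spanned by two quadratic forms that eliminates the leading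
coefficient vanishes at `[-(f_2 g_0 - g_2 f_0) : f_2 g_1 - g_2 f_1]`; the second coordinate. -/
def subresultant (f g : Fin 3 → R) : R := f 2 * g 1 - g 2 * f 1

theorem map_subresultant {R' : Type*} [CommRing R'] (φ : R →+* R') (f g : Fin 3 → R) :
    φ (subresultant f g) = subresultant (fun k => φ (f k)) fun k => φ (g k) := by
  simp [subresultant]

/-- If the resultant of `Q_1 - b_x Q_0` and `Q_2 - b_y Q_0` is zero, then their subresultant gives
a common root, at which all the coordinate polynomials vanish. -/
theorem subresultant_pow_mul_indexDet_eq_zero {n : ℕ} (hn : 1 ≤ n)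
    (B : Fin (n.choose 2) → Fin 2 → R) (q : Fin 3 → Fin 3 → R) (i : Fin (n.choose 2))
    (h0 : pointResultant (B i) (conic q) = 0) :
    subresultant (abscissaForm (B i) q) (ordinateForm (B i) q) ^ (2 * n - 1)
      * indexDet n B (conic q) = 0 := by
  rw [pointResultant_conic] at h0
  set f := abscissaForm (B i) q with hf
  set g := ordinateForm (B i) q with hg
  -- The combination `f_2 g - g_2 f` has no `u^2` term, so it is `v` times a linear form; `p` is the
  -- zero of that linear form. At `p`, `f` and `g` take the values `f_2 Res` and `g_2 Res`.
  set p : Fin 2 → R := ![-(f 2 * g 0 - g 2 * f 0), subresultant f g] with hp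
  have hf' : f 0 * p 1 ^ 2 + f 1 * (p 0 * p 1) + f 2 * p 0 ^ 2 = 0 := by
    have : f 0 * p 1 ^ 2 + f 1 * (p 0 * p 1) + f 2 * p 0 ^ 2 = f 2 * coeffResultant f g := by
      simp [hp, coeffResultant, subresultant]; ring
    rw [this, h0, mul_zero]
  have hg' : g 0 * p 1 ^ 2 + g 1 * (p 0 * p 1) + g 2 * p 0 ^ 2 = 0 := by
    have : g 0 * p 1 ^ 2 + g 1 * (p 0 * p 1) + g 2 * p 0 ^ 2 = g 2 * coeffResultant f g := by
      simp [hp, coeffResultant, subresultant]; ring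
    rw [this, h0, mul_zero]
  -- The factor `Q_0(p)` may be zero or a zero divisor: only proportionality is used, never
  -- division.
  have hQ : (fun k => eval p (conic q k))
      = fun k => eval p (conic q 0) * ![1, B i 0, B i 1] k := by
    funext k
    simp only [hf, hg, abscissaForm, ordinateForm] at hf' hg'
    fin_cases k
    · simp
    · simp only [eval_conic]
      simp
      linear_combination hf'
    · simp only [eval_conic]
      simp
      linear_combination hg'
  have hP : ∀ j, eval p (curveCoordinate n B (conic q) j) = 0 := by
    intro j
    simp only [curveCoordinate_eq_sum, map_sum, map_mul, eval_C]
    have : ∀ r, eval p (monomialValue n (conic q) r)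
        = eval p (conic q 0) ^ (n - 1) * monomialValue n ![1, B i 0, B i 1] r := by
      intro r
      rw [map_monomialValue, hQ, monomialValue_mul]
    simp only [this, mul_left_comm _ (eval p (conic q 0) ^ (n - 1)), ← Finset.mul_sum,
      sum_kernelMatrix_mul_monomialValue, mul_zero]
  set w : Fin (n * 2) → R := fun r => p 0 ^ (2 * n - 1 - (r : ℕ)) * p 1 ^ (r : ℕ) with hw
  set M := indexMatrix n (curveCoordinate n B (conic q)) with hM
  have hwM : Matrix.vecMul w M = 0 := by
    funext c
    have := sum_pow_mul_indexMatrix hn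
      (isHomogeneous_curveCoordinate B (isHomogeneous_conic q)) p c
    rw [hP, mul_zero] at this
    exact this
  -- Multiplication by the adjugate replaces inversion, so no domain is needed. The last entry of
  -- `w` is the pure power `p 1 ^ (2n-1)`.
  have hdet : M.det • w = 0 := by
    have : Matrix.vecMul w (M * M.adjugate) = 0 := by
      rw [← Matrix.vecMul_vecMul, hwM, Matrix.zero_vecMul]
    rwa [Matrix.mul_adjugate, Matrix.vecMul_smul, Matrix.vecMul_one] at this
  have := congrFun hdet ⟨2 * n - 1, by omega⟩
  simp only [Pi.smul_apply, hw, smul_eq_mul, Pi.zero_apply, Nat.sub_self, pow_zero, one_mul] at this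
  rw [mul_comm]
  exact this

/-- The vanishing statement is applied in the quotient by `ρ_i`, which need not be a domain. -/
theorem pointResultant_dvd_subresultant_pow_mul_indexDet {n : ℕ} (hn : 1 ≤ n)
    (B : Fin (n.choose 2) → Fin 2 → R) (q : Fin 3 → Fin 3 → R) (i : Fin (n.choose 2)) :
    pointResultant (B i) (conic q) ∣
      subresultant (abscissaForm (B i) q) (ordinateForm (B i) q) ^ (2 * n - 1)
        * indexDet n B (conic q) := by
  rw [← Ideal.mem_span_singleton, ← Ideal.Quotient.eq_zero_iff_mem]
  set φ := Ideal.Quotient.mk (Ideal.span {pointResultant (B i) (conic q)})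
  have h0 : φ (pointResultant (B i) (conic q)) = 0 :=
    Ideal.Quotient.eq_zero_iff_mem.mpr (Ideal.mem_span_singleton_self _)
  rw [map_pointResultant_conic] at h0
  have := subresultant_pow_mul_indexDet_eq_zero hn (fun i a => φ (B i a))
    (fun k l => φ (q k l)) i h0
  rw [map_mul, map_pow, map_indexDet_conic, map_subresultant]
  simp only [abscissaForm, ordinateForm, map_sub, map_mul] at this ⊢
  exact this

/-! ### Scaling the conic, and the conic `(0, u^2, v^2)` -/

/-- Replacing `Q` by `t Q` multiplies `Res(Q_1 - b_x Q_0, Q_2 - b_y Q_0)` by `t ^ 4`. -/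
theorem pointResultant_conic_mul (b : Fin 2 → R) (q : Fin 3 → Fin 3 → R) (t : R) :
    pointResultant b (conic fun k l => t * q k l) = t ^ 4 * pointResultant b (conic q) := by
  simp only [pointResultant_conic, coeffResultant, abscissaForm, ordinateForm]
  ring

theorem indexDet_conic_mul (n : ℕ) (B : Fin (n.choose 2) → Fin 2 → R) (q : Fin 3 → Fin 3 → R)
    (t : R) :
    indexDet n B (conic fun k l => t * q k l)
      = t ^ ((n - 1) * (n * 2)) * indexDet n B (conic q) := by
  rw [← indexDet_C_mul]
  congr 1
  funext k
  simp only [conic, map_mul]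
  ring

theorem expX_expY_injective (n : ℕ) :
    Function.Injective fun k : Fin (n.choose 2) => (expX n k, expY n k) := by
  intro k l h
  simp only [Prod.mk.injEq, expX, expY] at h
  apply (monomialNumbering n).symm.injective
  generalize (monomialNumbering n).symm k = s at h ⊢
  generalize (monomialNumbering n).symm l = t at h ⊢
  obtain ⟨d, j⟩ := s
  obtain ⟨d', j'⟩ := t
  obtain ⟨h1, h2⟩ := h
  simp only at h1 h2
  -- The bound `j ≤ d` makes the truncated difference in `expX` exact, so the two exponents recover
  -- `d`.
  have hj := j.isLt
  have hj' := j'.isLt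
  obtain rfl : d = d' := by ext; omega
  obtain rfl : j = j' := by ext; omega
  rfl

/-- The coefficients of the triple `(0, u ^ 2, v ^ 2)`. -/
def squaresCoeff (R : Type*) [CommRing R] : Fin 3 → Fin 3 → R :=
  ![![0, 0, 0], ![0, 0, 1], ![1, 0, 0]]

theorem pointResultant_squaresCoeff (b : Fin 2 → R) :
    pointResultant b (conic (squaresCoeff R)) = 1 := by
  simp [pointResultant_conic, coeffResultant, abscissaForm, ordinateForm, squaresCoeff]

theorem curveCoordinate_squaresCoeff (n : ℕ) (B : Fin (n.choose 2) → Fin 2 → R) (i : Fin n) :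
    curveCoordinate n B (conic (squaresCoeff R)) i
      = monomial (Finsupp.single 0 (2 * (n - 1 - (i : ℕ))) + Finsupp.single 1 (2 * (i : ℕ)))
          (interpolationMatrix n B).det := by
  have h0 : conic (squaresCoeff R) 0 = 0 := by simp [conic, squaresCoeff]
  have h1 : conic (squaresCoeff R) 1 = X 0 ^ 2 := by simp [conic, squaresCoeff]
  have h2 : conic (squaresCoeff R) 2 = X 1 ^ 2 := by simp [conic, squaresCoeff]
  rw [curveCoordinate_eq_sum, Fintype.sum_sum_type, Finset.sum_eq_zero, zero_add,
    Finset.sum_eq_single i]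
  · simp only [kernelMatrix, monomialValue, h1, h2, ← pow_mul, Matrix.fromRows_apply_inr,
      Matrix.smul_apply, Matrix.one_apply_eq, smul_eq_mul, mul_one]
    rw [X_pow_eq_monomial, X_pow_eq_monomial, monomial_mul, C_mul_monomial]
    simp
  · intro j _ hj
    simp [kernelMatrix, Matrix.one_apply_ne hj]
  · simp
  · intro k _
    have := expX_add_expY_lt k
    -- All monomials of the upper block are divisible by `Z`, and `Q_0 = 0` kills them.
    rw [monomialValue, h0, zero_pow (by omega)]
    simp

/-- The forms `u P'_i, v P'_i` are `det V_B` times the monomials of degree `2n-1`, already in the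
order of the rows. -/
theorem indexDet_squaresCoeff (n : ℕ) (B : Fin (n.choose 2) → Fin 2 → R) :
    indexDet n B (conic (squaresCoeff R)) = (interpolationMatrix n B).det ^ (2 * n) := by
  have h : indexMatrix n (curveCoordinate n B (conic (squaresCoeff R)))
      = (interpolationMatrix n B).det • 1 := by
    ext r c
    rw [indexMatrix, Matrix.of_apply, curveCoordinate_squaresCoeff, X, monomial_mul, one_mul,
      coeff_monomial, Matrix.smul_apply, Matrix.one_apply, smul_eq_mul, mul_ite, mul_one, mul_zero]
    have hc : (c : ℕ) = 2 * (c.divNat : ℕ) + (c.modNat : ℕ) := by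
      simp only [Fin.coe_divNat, Fin.coe_modNat]; omega
    have hd := c.divNat.isLt
    have hr := r.isLt
    refine if_congr ?_ rfl rfl
    generalize c.divNat = d at *
    generalize c.modNat = e at *
    rw [Finsupp.ext_iff, Fin.forall_fin_two]
    rw [Fin.ext_iff]
    fin_cases e <;> simp at * <;> omega
  rw [indexDet, h, Matrix.det_smul, Fintype.card_fin, Matrix.det_one, mul_one, mul_comm n 2]

/-! ### Divisors and the variables they involve -/

section Free

variable {σ K : Type*} [Field K]

/-- Degrees in a single variable add over a domain. The coprimality proofs use this to free a common
divisor of some variables, which may then be specialized at will. -/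
theorem vars_subset_vars_of_dvd {h p : MvPolynomial σ K} (hp : p ≠ 0) (hd : h ∣ p) :
    h.vars ⊆ p.vars := by
  obtain ⟨g, rfl⟩ := hd
  intro x hx
  have hh : h ≠ 0 := left_ne_zero_of_mul hp
  have hg : g ≠ 0 := right_ne_zero_of_mul hp
  by_contra hx'
  classical
  have key : ∀ p : MvPolynomial σ K, x ∉ p.vars ↔ degreeOf x p = 0 := fun p => by
    rw [vars_def, degreeOf_def, Multiset.mem_toFinset, Multiset.count_eq_zero]
  rw [key, degreeOf_mul_eq hh hg] at hx'
  exact (key h).mpr (Nat.eq_zero_of_add_eq_zero_right hx') hx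

theorem mem_supported_of_dvd {s : Set σ} {h p : MvPolynomial σ K} (hp : p ≠ 0) (hd : h ∣ p)
    (hs : p ∈ supported K s) : h ∈ supported K s := by
  rw [mem_supported] at hs ⊢
  exact (Finset.coe_subset.mpr (vars_subset_vars_of_dvd hp hd)).trans hs

theorem mem_supported_inter {s t : Set σ} {h : MvPolynomial σ K} (hs : h ∈ supported K s)
    (ht : h ∈ supported K t) : h ∈ supported K (s ∩ t) := by
  rw [mem_supported] at *
  exact Set.subset_inter hs ht

theorem aeval_eq_self_of_mem_supported {s : Set σ} {h : MvPolynomial σ K}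
    (hs : h ∈ supported K s) {y : σ → MvPolynomial σ K} (hy : ∀ x ∈ s, y x = X x) :
    aeval y h = h := by
  rw [mem_supported] at hs
  have := hom_congr_vars (f₁ := (aeval y : _ →ₐ[K] MvPolynomial σ K).toRingHom)
    (f₂ := RingHom.id _) (p₁ := h) (p₂ := h) (by ext; simp [algebraMap_eq])
    (fun i hi _ => by simpa using hy i (hs hi)) rfl
  simpa using this

/-- A divisor of `p` that does not involve the variables changed by a substitution divides the
result of the substitution. -/
theorem dvd_aeval_of_mem_supported {s : Set σ} {h p : MvPolynomial σ K}
    (hs : h ∈ supported K s) {y : σ → MvPolynomial σ K} (hy : ∀ x ∈ s, y x = X x)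
    (hd : h ∣ p) : h ∣ aeval y p := by
  have := map_dvd (aeval y : _ →ₐ[K] MvPolynomial σ K) hd
  rwa [aeval_eq_self_of_mem_supported hs hy] at this

end Free

section Membership

variable {R S : Type*} [CommRing R] [CommRing S] [Algebra R S] {T : Subalgebra R S}

theorem coeffResultant_mem {f g : Fin 3 → S} (hf : ∀ k, f k ∈ T) (hg : ∀ k, g k ∈ T) :
    coeffResultant f g ∈ T := by
  unfold coeffResultant
  refine T.sub_mem (T.pow_mem (T.sub_mem ?_ ?_) _) (T.mul_mem (T.sub_mem ?_ ?_) (T.sub_mem ?_ ?_))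
  all_goals
    exact T.mul_mem (by first | exact hf _ | exact hg _) (by first | exact hf _ | exact hg _)

theorem pointResultant_conic_mem {b : Fin 2 → S} {q : Fin 3 → Fin 3 → S} (hb : ∀ a, b a ∈ T)
    (hq : ∀ k l, q k l ∈ T) : pointResultant b (conic q) ∈ T := by
  rw [pointResultant_conic]
  exact coeffResultant_mem (fun k => T.sub_mem (hq _ _) (T.mul_mem (hb _) (hq _ _)))
    fun k => T.sub_mem (hq _ _) (T.mul_mem (hb _) (hq _ _))

end Membership

/-! ### The generic configuration and its specializations -/

variable {K : Type*} [Field K] {n : ℕ}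

/-- The matrix of coefficients of the generic parameterized conic. -/
noncomputable def genericCoeff (K : Type*) [CommRing K] (n : ℕ) :
    Fin 3 → Fin 3 → MvPolynomial (Coord n) K :=
  fun k l => X (Sum.inr (k, l))

theorem genericConic_eq (K : Type*) [CommRing K] (n : ℕ) :
    genericConic K n = conic (genericCoeff K n) := rfl

theorem aeval_pointResultant {A : Type*} [CommRing A] [Algebra K A] (y : Coord n → A)
    (i : Fin (n.choose 2)) :
    aeval y (pointResultant (genericPoints K n i) (genericConic K n))
      = pointResultant (fun a => y (Sum.inl (i, a))) (conic fun k l => y (Sum.inr (k, l))) := by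
  have := map_pointResultant_conic (aeval y : MvPolynomial (Coord n) K →ₐ[K] A).toRingHom
    (genericPoints K n i) (genericCoeff K n)
  simpa [genericPoints, genericCoeff, genericConic_eq] using this

theorem aeval_indexDet {A : Type*} [CommRing A] [Algebra K A] (y : Coord n → A) :
    aeval y (indexDet n (genericPoints K n) (genericConic K n))
      = indexDet n (fun i a => y (Sum.inl (i, a))) (conic fun k l => y (Sum.inr (k, l))) := by
  have := map_indexDet_conic (aeval y : MvPolynomial (Coord n) K →ₐ[K] A).toRingHom n
    (genericPoints K n) (genericCoeff K n)
  simpa [genericPoints, genericCoeff, genericConic_eq] using this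

theorem aeval_det_interpolationMatrix {A : Type*} [CommRing A] [Algebra K A] (y : Coord n → A) :
    aeval y (interpolationMatrix n (genericPoints K n)).det
      = (interpolationMatrix n fun i a => y (Sum.inl (i, a))).det := by
  have := map_det_interpolationMatrix (aeval y : MvPolynomial (Coord n) K →ₐ[K] A).toRingHom n
    (genericPoints K n)
  simpa [genericPoints] using this

/-- Coordinates that specialize the conic to `(0, u ^ 2, v ^ 2)` and keep the points. -/
noncomputable def squaresPoint (K : Type*) [Field K] (n : ℕ) :
    Coord n → MvPolynomial (Coord n) K :=
  Sum.elim (fun x => X (Sum.inl x)) fun x => squaresCoeff _ x.1 x.2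

theorem aeval_squaresPoint_pointResultant (i : Fin (n.choose 2)) :
    aeval (squaresPoint K n) (pointResultant (genericPoints K n i) (genericConic K n)) = 1 := by
  rw [aeval_pointResultant]
  exact pointResultant_squaresCoeff _

theorem aeval_squaresPoint_det :
    aeval (squaresPoint K n) (interpolationMatrix n (genericPoints K n)).det
      = (interpolationMatrix n (genericPoints K n)).det := by
  rw [aeval_det_interpolationMatrix]
  rfl

theorem aeval_squaresPoint_indexDet :
    aeval (squaresPoint K n) (indexDet n (genericPoints K n) (genericConic K n))
      = (interpolationMatrix n (genericPoints K n)).det ^ (2 * n) := by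
  rw [aeval_indexDet]
  exact indexDet_squaresCoeff n (genericPoints K n)

theorem pointResultant_generic_ne_zero (i : Fin (n.choose 2)) :
    pointResultant (genericPoints K n i) (genericConic K n) ≠ 0 := by
  intro h
  have := aeval_squaresPoint_pointResultant (K := K) i
  rw [h, map_zero] at this
  exact zero_ne_one this

theorem X_sub_X_mul_X_ne_zero {σ : Type*} {a b c : σ} (hb : b ≠ a) :
    (X a - X b * X c : MvPolynomial σ K) ≠ 0 := by
  classical
  intro h0
  have := congrArg (eval (Pi.single a 1)) h0
  simp [hb] at this

/-- A common divisor `h` is free of the constant coefficients `q_{k,0}`, since the subresultant is.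
Modulo the subresultant, `ρ_i` is `(f_2 g_0 - g_2 f_0)^2`, where the `q_{k,0}` can be chosen freely;
two choices give `h ∣ f_2^2` and `h ∣ g_2^2`, and these squares are coprime. -/
theorem isRelPrime_subresultant_pointResultant (i : Fin (n.choose 2)) :
    IsRelPrime (subresultant (abscissaForm (genericPoints K n i) (genericCoeff K n))
        (ordinateForm (genericPoints K n i) (genericCoeff K n)))
      (pointResultant (genericPoints K n i) (genericConic K n)) := by
  intro h h1 h2
  have hX : ∀ {s : Set (Coord n)} {x : Coord n}, x ∈ s → X x ∈ supported K s := fun hx =>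
    X_mem_supported.mpr hx
  -- the divisor does not involve the constant coefficients of the conic
  have hs : h ∈ supported K {x : Coord n | ∀ k, x ≠ Sum.inr (k, 0)} := by
    refine mem_supported_of_dvd ?_ h1 ?_
    · intro h0
      -- At `b = 0`, `Q_1 = u^2`, `Q_2 = uv` the subresultant is `1`.
      have := map_subresultant
        (aeval (Sum.elim (fun _ => 0) fun x => (![![0, 0, 0], ![0, 0, 1], ![0, 1, 0]] :
          Fin 3 → Fin 3 → K) x.1 x.2) : MvPolynomial (Coord n) K →ₐ[K] K).toRingHom
        (abscissaForm (genericPoints K n i) (genericCoeff K n))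
        (ordinateForm (genericPoints K n i) (genericCoeff K n))
      rw [h0] at this
      simp [subresultant, abscissaForm, ordinateForm, genericPoints, genericCoeff] at this
    · have hb : ∀ a, genericPoints K n i a ∈ supported K {x : Coord n | ∀ k, x ≠ Sum.inr (k, 0)} :=
        fun a => hX (by simp)
      have hq : ∀ k l, l ≠ 0 → genericCoeff K n k l ∈
          supported K {x : Coord n | ∀ k, x ≠ Sum.inr (k, 0)} :=
        fun k l hl => hX (by simp [hl])
      have hf : ∀ l, l ≠ 0 → abscissaForm (genericPoints K n i) (genericCoeff K n) l ∈
          supported K {x : Coord n | ∀ k, x ≠ Sum.inr (k, 0)} := fun l hl =>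
        Subalgebra.sub_mem _ (hq _ _ hl) (Subalgebra.mul_mem _ (hb _) (hq _ _ hl))
      have hg : ∀ l, l ≠ 0 → ordinateForm (genericPoints K n i) (genericCoeff K n) l ∈
          supported K {x : Coord n | ∀ k, x ≠ Sum.inr (k, 0)} := fun l hl =>
        Subalgebra.sub_mem _ (hq _ _ hl) (Subalgebra.mul_mem _ (hb _) (hq _ _ hl))
      exact Subalgebra.sub_mem _ (Subalgebra.mul_mem _ (hf _ (by decide)) (hg _ (by decide)))
        (Subalgebra.mul_mem _ (hg _ (by decide)) (hf _ (by decide)))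
  have key : ∀ c : Fin 3 → MvPolynomial (Coord n) K,
      h ∣ (abscissaForm (genericPoints K n i) (genericCoeff K n) 2
            * (c 2 - genericPoints K n i 1 * c 0)
          - ordinateForm (genericPoints K n i) (genericCoeff K n) 2
            * (c 1 - genericPoints K n i 0 * c 0)) ^ 2 := by
    intro c
    have := dvd_aeval_of_mem_supported hs
      (y := Sum.elim (fun x => X (Sum.inl x)) fun x => if x.2 = 0 then c x.1 else X (Sum.inr x))
      (by rintro (x | ⟨k, l⟩) hx
          · rfl
          · have : l ≠ 0 := fun hl => hx k (by rw [hl])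
            simp [this]) h2
    rw [aeval_pointResultant, pointResultant_conic] at this
    convert dvd_add this (h1.mul_right
      (abscissaForm (genericPoints K n i) (genericCoeff K n) 1
            * (c 2 - genericPoints K n i 1 * c 0)
          - ordinateForm (genericPoints K n i) (genericCoeff K n) 1
            * (c 1 - genericPoints K n i 0 * c 0))) using 1
    simp [coeffResultant, subresultant, abscissaForm, ordinateForm, genericPoints, genericCoeff]
  -- These constant coefficients make the squared expression `f_2` and `g_2` respectively.
  have hf := key ![0, 0, 1]
  have hg := key ![0, -1, 0]
  replace hf : h ∣ (X (Sum.inr (1, 2)) - X (Sum.inl (i, 0)) * X (Sum.inr (0, 2))) ^ 2 := by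
    simpa [abscissaForm, genericPoints, genericCoeff] using hf
  replace hg : h ∣ (X (Sum.inr (2, 2)) - X (Sum.inl (i, 1)) * X (Sum.inr (0, 2))) ^ 2 := by
    simpa [ordinateForm, genericPoints, genericCoeff] using hg
  have hf' : h ∈ supported K {x : Coord n | ∀ l, x ≠ Sum.inr (2, l)} := by
    refine mem_supported_of_dvd ?_ hf ?_
    · exact pow_ne_zero _ (X_sub_X_mul_X_ne_zero (by simp))
    · refine Subalgebra.pow_mem _ (Subalgebra.sub_mem _ (hX ?_)
        (Subalgebra.mul_mem _ (hX ?_) (hX ?_))) _ <;>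
        simp
  have hg' : h ∈ supported K {x : Coord n | (∀ l, x ≠ Sum.inr (1, l)) ∧ x ≠ Sum.inl (i, 0)} := by
    refine mem_supported_of_dvd ?_ hg ?_
    · exact pow_ne_zero _ (X_sub_X_mul_X_ne_zero (by simp))
    · refine Subalgebra.pow_mem _ (Subalgebra.sub_mem _ (hX ?_)
        (Subalgebra.mul_mem _ (hX ?_) (hX ?_))) _ <;>
        simp
  -- Since `h` involves neither `b_x` nor `Q_1`, setting `b_x = 0` and `q_{1,2} = 1` turns `f_2^2`
  -- into `1` and fixes `h`.
  have := dvd_aeval_of_mem_supported hg'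
      (y := Sum.elim (fun x => if x = (i, 0) then 0 else X (Sum.inl x))
        fun x => if x.1 = 1 then 1 else X (Sum.inr x))
      (by rintro (x | ⟨k, l⟩) hx
          · have : x ≠ (i, 0) := fun hl => hx.2 (by rw [hl])
            simp [this]
          · have : k ≠ 1 := fun hl => hx.1 l (by rw [hl])
            simp [this]) hf
  simp at this
  exact isUnit_of_dvd_one this

theorem genericPoints_mem_supported {s : Set (Coord n)} {i : Fin (n.choose 2)} {a : Fin 2}
    (h : Sum.inl (i, a) ∈ s) : genericPoints K n i a ∈ supported K s :=
  X_mem_supported.mpr h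

theorem genericCoeff_mem_supported {s : Set (Coord n)} {k l : Fin 3}
    (h : Sum.inr (k, l) ∈ s) : genericCoeff K n k l ∈ supported K s :=
  X_mem_supported.mpr h

theorem pointResultant_mem_supported (i : Fin (n.choose 2)) :
    pointResultant (genericPoints K n i) (genericConic K n) ∈
      supported K {x : Coord n | ∀ z, x = Sum.inl z → z.1 = i} := by
  rw [genericConic_eq]
  exact pointResultant_conic_mem
    (fun a => genericPoints_mem_supported fun z hz => by rw [← Sum.inl.inj hz])
    fun k l => genericCoeff_mem_supported (by simp)

theorem coeffResultant_genericCoeff_ne_zero :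
    coeffResultant (genericCoeff K n 1) (genericCoeff K n 2) ≠ 0 := by
  intro h0
  have := congrArg (aeval (Sum.elim (fun _ => (0 : K)) fun x => squaresCoeff K x.1 x.2) :
    MvPolynomial (Coord n) K →ₐ[K] K) h0
  simp [coeffResultant, genericCoeff, squaresCoeff] at this

/-- Resultants of `Q_2` with `u^2` and with `v^2` are `q_{2,0}^2` and `q_{2,2}^2`, which are
coprime. -/
theorem isUnit_of_dvd_coeffResultant {h : MvPolynomial (Coord n) K}
    (key : ∀ c : Fin 3 → MvPolynomial (Coord n) K, h ∣ coeffResultant c (genericCoeff K n 2)) :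
    IsUnit h := by
  have h4 : h ∣ genericCoeff K n 2 0 ^ 2 := by
    have := key ![0, 0, 1]
    simp only [coeffResultant] at this
    simpa using this
  have h5 : h ∣ genericCoeff K n 2 2 ^ 2 := by
    have := key ![1, 0, 0]
    simp only [coeffResultant] at this
    simpa using this
  have h6 := dvd_aeval_of_mem_supported
    (mem_supported_of_dvd (pow_ne_zero _ (X_ne_zero _)) h4
      (Subalgebra.pow_mem _ (genericCoeff_mem_supported (Set.mem_singleton _)) _))
    (y := fun x => if x = Sum.inr (2, 2) then 1 else X x) (by rintro x rfl; simp) h5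
  exact isUnit_of_dvd_one (by simpa [genericCoeff] using h6)

/-- A common divisor involves no point coordinates. Setting the points to `0` shows that it divides
`Res(Q_1, Q_2)`, so it is free of `Q_0` as well. -/
theorem isRelPrime_pointResultant {i j : Fin (n.choose 2)} (hij : i ≠ j) :
    IsRelPrime (pointResultant (genericPoints K n i) (genericConic K n))
      (pointResultant (genericPoints K n j) (genericConic K n)) := by
  intro h h1 h2
  have hs := mem_supported_inter
    (mem_supported_of_dvd (pointResultant_generic_ne_zero i) h1 (pointResultant_mem_supported i))
    (mem_supported_of_dvd (pointResultant_generic_ne_zero j) h2 (pointResultant_mem_supported j))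
  -- the divisor does not involve the points
  have hB : ∀ z, Sum.inl z ∉ {x : Coord n | ∀ z, x = Sum.inl z → z.1 = i} ∩
      {x : Coord n | ∀ z, x = Sum.inl z → z.1 = j} := fun z hz =>
    hij ((hz.1 z rfl).symm.trans (hz.2 z rfl))
  have h3 : h ∣ coeffResultant (genericCoeff K n 1) (genericCoeff K n 2) := by
    have := dvd_aeval_of_mem_supported hs (y := Sum.elim (fun _ => 0) fun x => X (Sum.inr x))
      (by rintro (z | z) hz
          · exact absurd hz (hB z)
          · rfl) h1
    rw [aeval_pointResultant, pointResultant_conic] at this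
    convert this using 2 <;> funext k
    · simp only [abscissaForm, Sum.elim_inl, Sum.elim_inr, zero_mul, sub_zero]; rfl
    · simp only [ordinateForm, Sum.elim_inl, Sum.elim_inr, zero_mul, sub_zero]; rfl
  have hs' : h ∈ supported K {x : Coord n | ∀ l, x ≠ Sum.inr (0, l)} :=
    mem_supported_of_dvd coeffResultant_genericCoeff_ne_zero h3
      (coeffResultant_mem (fun k => genericCoeff_mem_supported (by simp))
        fun k => genericCoeff_mem_supported (by simp))
  -- With `b_i = (1, 0)` and `Q_0 = Q_1 - c`, the first form `Q_1 - b_x Q_0` becomes an arbitrary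
  -- `c` and the second is `Q_2`.
  refine isUnit_of_dvd_coeffResultant fun c => ?_
  have := dvd_aeval_of_mem_supported (mem_supported_inter hs hs')
    (y := Sum.elim (fun z => if z.2 = 0 then 1 else 0) fun z =>
      if z.1 = 0 then X (Sum.inr (1, z.2)) - c z.2 else X (Sum.inr z))
    (by rintro (z | ⟨k, l⟩) hz
        · exact absurd hz.1 (hB z)
        · have : k ≠ 0 := fun hk => hz.2 l (by rw [hk])
          simp [this]) h1
  rw [aeval_pointResultant, pointResultant_conic] at this
  convert this using 2 <;> funext k
  · simp [abscissaForm]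
  · simp [ordinateForm, genericCoeff]

/-! ### Divisibility and comparison of degrees -/

theorem pointResultant_dvd_indexDet (hn : 1 ≤ n) (i : Fin (n.choose 2)) :
    pointResultant (genericPoints K n i) (genericConic K n) ∣
      indexDet n (genericPoints K n) (genericConic K n) :=
  IsRelPrime.dvd_of_dvd_mul_left
    (isRelPrime_subresultant_pointResultant i).symm.pow_right
    (pointResultant_dvd_subresultant_pow_mul_indexDet hn (genericPoints K n) (genericCoeff K n) i)

theorem resultantProd_dvd_indexDet (hn : 1 ≤ n) :
    resultantProd n (genericPoints K n) (genericConic K n) ∣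
      indexDet n (genericPoints K n) (genericConic K n) :=
  Finset.prod_dvd_of_isRelPrime (fun _ _ _ _ hij => isRelPrime_pointResultant hij)
    fun i _ => pointResultant_dvd_indexDet hn i

theorem resultantProd_generic_ne_zero :
    resultantProd n (genericPoints K n) (genericConic K n) ≠ 0 :=
  Finset.prod_ne_zero_iff.mpr fun i _ => pointResultant_generic_ne_zero i

/-- Coordinates that multiply the generic conic by a new variable and keep the points. -/
noncomputable def scaledPoint (K : Type*) [Field K] (n : ℕ) :
    Coord n → Polynomial (MvPolynomial (Coord n) K) :=
  Sum.elim (fun x => Polynomial.C (X (Sum.inl x)))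
    fun x => Polynomial.X * Polynomial.C (X (Sum.inr x))

theorem aeval_scaledPoint_pointResultant (i : Fin (n.choose 2)) :
    aeval (scaledPoint K n) (pointResultant (genericPoints K n i) (genericConic K n))
      = Polynomial.X ^ 4
        * Polynomial.C (pointResultant (genericPoints K n i) (genericConic K n)) := by
  rw [aeval_pointResultant, genericConic_eq, map_pointResultant_conic, ← pointResultant_conic_mul]
  rfl

theorem aeval_scaledPoint_indexDet :
    aeval (scaledPoint K n) (indexDet n (genericPoints K n) (genericConic K n))
      = Polynomial.X ^ ((n - 1) * (n * 2))
        * Polynomial.C (indexDet n (genericPoints K n) (genericConic K n)) := by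
  rw [aeval_indexDet, genericConic_eq, map_indexDet_conic, ← indexDet_conic_mul]
  rfl

theorem indexDet_generic (hn : 1 ≤ n) :
    indexDet n (genericPoints K n) (genericConic K n)
      = (interpolationMatrix n (genericPoints K n)).det ^ (2 * n)
        * resultantProd n (genericPoints K n) (genericConic K n) := by
  obtain ⟨g, hg⟩ := resultantProd_dvd_indexDet (K := K) hn
  have hdeg : (n - 1) * (n * 2) = 4 * n.choose 2 := by
    have h := Nat.choose_two_right n
    have := Nat.div_mul_cancel (Nat.even_mul_pred_self n).two_dvd
    rw [← h] at this
    nlinarith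
  -- the quotient is invariant under scaling the conic
  have hscale : aeval (scaledPoint K n) g = Polynomial.C g := by
    have h := aeval_scaledPoint_indexDet (K := K) (n := n)
    rw [hg, map_mul, resultantProd, map_prod] at h
    simp only [aeval_scaledPoint_pointResultant, Finset.prod_mul_distrib, Finset.prod_const,
      Finset.card_univ, Fintype.card_fin, ← pow_mul, ← hdeg, map_mul, map_prod, mul_assoc] at h
    have h' := mul_left_cancel₀ (pow_ne_zero _ Polynomial.X_ne_zero) h
    refine mul_left_cancel₀ (Finset.prod_ne_zero_iff.mpr fun i _ => ?_) h'
    exact Polynomial.C_ne_zero.mpr (pointResultant_generic_ne_zero i)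
  -- Scale invariance at `t = 0` gives `g(B, Q) = g(B, 0)`, so every specialization of `Q` that
  -- keeps `B` fixes `g`.
  have hg' : aeval (squaresPoint K n) g = g := by
    have h0 : ((Polynomial.aeval (0 : MvPolynomial (Coord n) K)).restrictScalars K).comp
        (aeval (scaledPoint K n)) = aeval (Sum.elim (fun x => X (Sum.inl x)) fun _ => 0) := by
      ext (x | x) : 1 <;> simp [scaledPoint]
    have h1 := DFunLike.congr_fun h0 g
    simp only [AlgHom.comp_apply, hscale, AlgHom.restrictScalars_apply, Polynomial.aeval_C,
      Algebra.algebraMap_self, RingHom.id_apply] at h1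
    have h2 : (aeval (squaresPoint K n) : _ →ₐ[K] MvPolynomial (Coord n) K).comp
        (aeval (Sum.elim (fun x => X (Sum.inl x)) fun _ => 0 :
          Coord n → MvPolynomial (Coord n) K))
        = aeval (Sum.elim (fun x => X (Sum.inl x)) fun _ => 0) := by
      ext (x | x) : 1 <;> simp [squaresPoint]
    have h3 := DFunLike.congr_fun h2 g
    rwa [AlgHom.comp_apply, ← h1] at h3
  have h := aeval_squaresPoint_indexDet (K := K) (n := n)
  rw [hg, map_mul, resultantProd, map_prod, hg'] at h
  simp only [aeval_squaresPoint_pointResultant, Finset.prod_const_one, one_mul] at h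
  rw [hg, h, mul_comm]

/-! ### Nonzero and nonunit factors -/

/-- The generic interpolation matrix is nonsingular: its Leibniz expansion has no cancellation. -/
theorem det_interpolationMatrix_generic_ne_zero (K : Type*) [Field K] (n : ℕ) :
    (interpolationMatrix n (genericPoints K n)).det ≠ 0 := by
  set μ : Equiv.Perm (Fin (n.choose 2)) → (Coord n →₀ ℕ) := fun σ =>
    ∑ k, (Finsupp.single (Sum.inl (σ k, 0)) (expX n k)
      + Finsupp.single (Sum.inl (σ k, 1)) (expY n k)) with hμ
  have hprod : ∀ σ : Equiv.Perm (Fin (n.choose 2)),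
      ∏ k, interpolationMatrix n (genericPoints K n) (σ k) k = monomial (μ σ) 1 := by
    intro σ
    rw [hμ, monomial_sum_one]
    refine Finset.prod_congr rfl fun k _ => ?_
    simp only [interpolationMatrix, Matrix.of_apply, genericPoints, X_pow_eq_monomial,
      monomial_mul, one_mul]
  have hx : ∀ σ k, μ σ (Sum.inl (σ k, 0)) = expX n k := by
    intro σ k
    simp [hμ, Finsupp.finsetSum_apply, Finsupp.single_apply]
  have hy : ∀ σ k, μ σ (Sum.inl (σ k, 1)) = expY n k := by
    intro σ k
    simp [hμ, Finsupp.finsetSum_apply, Finsupp.single_apply]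
  -- The variables of the point `σ k` carry the exponents of the `k`-th monomial in `μ σ` and of the
  -- `σ k`-th in `μ 1`; distinct monomials have distinct exponents.
  have hinj : ∀ σ, μ σ = μ 1 → σ = 1 := by
    intro σ h
    ext1 k
    apply expX_expY_injective n
    have h1 := hx 1 (σ k)
    have h2 := hy 1 (σ k)
    rw [← h] at h1 h2
    simp only [Equiv.Perm.one_apply] at h1 h2 ⊢
    rw [hx] at h1
    rw [hy] at h2
    simp [h1, h2]
  intro h0
  have h := congrArg (coeff (μ 1)) h0
  rw [Matrix.det_apply, coeff_sum, Finset.sum_eq_single 1] at h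
  · rw [hprod] at h
    simp at h
  · intro σ _ hσ
    rw [hprod, coeff_smul, coeff_monomial, if_neg fun e => hσ (hinj σ e), smul_zero]
  · simp

/-- With all points at the origin the rows coincide, and `n ≥ 3` provides at least two of them. -/
theorem not_isUnit_det_interpolationMatrix_generic (hn : 3 ≤ n) :
    ¬ IsUnit (interpolationMatrix n (genericPoints K n)).det := by
  intro h
  have hm : 1 < n.choose 2 :=
    lt_of_lt_of_le (by decide : 1 < Nat.choose 3 2) (Nat.choose_le_choose 2 hn)
  have := h.map (aeval (0 : Coord n → K))
  rw [aeval_det_interpolationMatrix,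
    Matrix.det_zero_of_row_eq (i := ⟨0, zero_lt_one.trans hm⟩) (j := ⟨1, hm⟩) (by simp) (by
      funext k; simp [interpolationMatrix])] at this
  exact not_isUnit_zero this

theorem not_isUnit_pointResultant_generic (i : Fin (n.choose 2)) :
    ¬ IsUnit (pointResultant (genericPoints K n i) (genericConic K n)) := by
  intro h
  have := h.map (aeval (0 : Coord n → K))
  rw [aeval_pointResultant, pointResultant_conic] at this
  simp [coeffResultant, abscissaForm, ordinateForm] at this

end ConicIndex

/-! ### The identity and the uniqueness of the exponents -/

theorem corollary4p13 (K : Type*) [Field K] (n : ℕ) (hn : 3 ≤ n) :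
    ConicIndex.indexDet n (ConicIndex.genericPoints K n) (ConicIndex.genericConic K n)
        = (ConicIndex.interpolationMatrix n (ConicIndex.genericPoints K n)).det ^ (2 * n)
          * ConicIndex.resultantProd n (ConicIndex.genericPoints K n)
              (ConicIndex.genericConic K n) ∧
    ∀ (c : K) (d : ℕ) (N : Fin (n.choose 2) → ℕ), 0 < d → (∀ i, 0 < N i) →
      ConicIndex.indexDet n (ConicIndex.genericPoints K n) (ConicIndex.genericConic K n)
        = MvPolynomial.C c
          * (ConicIndex.interpolationMatrix n (ConicIndex.genericPoints K n)).det ^ d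
          * ∏ i, ConicIndex.pointResultant (ConicIndex.genericPoints K n i)
              (ConicIndex.genericConic K n) ^ N i →
      c = 1 ∧ d = 2 * n ∧ ∀ i, N i = 1 := by
  have main := ConicIndex.indexDet_generic (K := K) (show 1 ≤ n by omega)
  refine ⟨main, fun c d N _ hN h => ?_⟩
  have hD := ConicIndex.det_interpolationMatrix_generic_ne_zero K n
  have hD' := ConicIndex.not_isUnit_det_interpolationMatrix_generic (K := K) hn
  -- At `(0, u^2, v^2)` the resultants become `1`, leaving `D ^ (2n) = c D ^ d`.
  have hs := congrArg (MvPolynomial.aeval (ConicIndex.squaresPoint K n)) h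
  rw [ConicIndex.aeval_squaresPoint_indexDet] at hs
  simp only [map_mul, map_pow, map_prod, ConicIndex.aeval_squaresPoint_det,
    ConicIndex.aeval_squaresPoint_pointResultant, one_pow, Finset.prod_const_one, mul_one,
    MvPolynomial.aeval_C, MvPolynomial.algebraMap_eq] at hs
  set D := (ConicIndex.interpolationMatrix n (ConicIndex.genericPoints K n)).det
  have hc : c ≠ 0 := by
    rintro rfl
    rw [map_zero, zero_mul] at hs
    exact pow_ne_zero _ hD hs
  have hcu : IsUnit (MvPolynomial.C c : MvPolynomial (ConicIndex.Coord n) K) :=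
    hc.isUnit.map MvPolynomial.C
  have hd : d = 2 * n := by
    -- If the exponents differed, cancellation would make a positive power of `D` a unit.
    rcases lt_trichotomy d (2 * n) with hlt | heq | hlt
    · obtain ⟨e, he⟩ := Nat.exists_eq_add_of_lt hlt
      exfalso
      rw [he, add_assoc, pow_add, mul_comm (D ^ d)] at hs
      have := mul_right_cancel₀ (pow_ne_zero _ hD) hs
      rw [← this] at hcu
      exact hD' ((isUnit_pow_iff (by omega)).mp hcu)
    · exact heq
    · obtain ⟨e, rfl⟩ := Nat.exists_eq_add_of_lt hlt
      exfalso
      rw [add_assoc, pow_add, mul_left_comm] at hs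
      have := mul_left_cancel₀ (pow_ne_zero _ hD) ((mul_one _).trans hs)
      exact hD' ((isUnit_pow_iff (by omega)).mp (IsUnit.of_mul_eq_one_right _ this.symm))
  subst hd
  have hc1 : MvPolynomial.C c = (1 : MvPolynomial (ConicIndex.Coord n) K) :=
    mul_right_cancel₀ (pow_ne_zero _ hD) (hs.symm.trans (one_mul _).symm)
  refine ⟨MvPolynomial.C_injective _ K (by rw [hc1, map_one]), rfl, fun i => ?_⟩
  rw [main, hc1, one_mul] at h
  have hprod := mul_left_cancel₀ (pow_ne_zero _ hD) h
  -- As `N i ≥ 1`, one copy of `ℛ` cancels. The remaining product of the `ρ_i ^ (N i - 1)` is `1`,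
  -- so no nonunit `ρ_i` can occur in it.
  have hsplit : ∀ i, ConicIndex.pointResultant (ConicIndex.genericPoints K n i)
        (ConicIndex.genericConic K n) ^ N i
      = ConicIndex.pointResultant (ConicIndex.genericPoints K n i) (ConicIndex.genericConic K n)
        * ConicIndex.pointResultant (ConicIndex.genericPoints K n i)
          (ConicIndex.genericConic K n) ^ (N i - 1) := fun i => by
    rw [← pow_succ', Nat.sub_add_cancel (hN i)]
  rw [Finset.prod_congr rfl fun i _ => hsplit i, Finset.prod_mul_distrib] at hprod
  have hone := mul_left_cancel₀ ConicIndex.resultantProd_generic_ne_zero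
    ((mul_one _).trans hprod)
  by_contra hne
  have hdvd := Finset.dvd_prod_of_mem (fun i => ConicIndex.pointResultant
    (ConicIndex.genericPoints K n i) (ConicIndex.genericConic K n) ^ (N i - 1)) (Finset.mem_univ i)
  rw [← hone] at hdvd
  have hNi := hN i
  exact ConicIndex.not_isUnit_pointResultant_generic i
    ((isUnit_pow_iff (by omega)).mp (isUnit_of_dvd_one hdvd))
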